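/- Let $n\ge 0$ be an integer and $0<\rho<\infty$. Write $\log^n$ and $\exp^n$ for the $n$-th iterates of $\log$ and $\exp$ (with $\log^0 t=\exp^0 t=t$), and put $$p(t)=(\log^n t)^{1/\rho}\quad (t\ge \exp^n 2),\qquad k_0=\lfloor \exp^n 2\rfloor+1,\qquad n_k=\left\lfloor \frac{p(k)}{p'(k)}\right\rfloor\quad (k\geq k_0).$$ Consider the series $$g(z)=2\sum_{k=k_0+1}^{\infty}\frac{p(k)^{n_k}z^{n_k}}{z^{2n_k}-p(k)^{2n_k}},$$ where the terms with $n_k=0$ (there are at most finitely many, and none unless $\rho$ is small), for which the expression is not defined, are omitted. Then the series converges locally uniformly in $\mathbb{C}$ (that is, on every compact set all but finitely many terms are holomorphic and the series of the remaining terms converges uniformly), so that $g$ is defined, and $g$ is meromorphic in $\mathbb{C}$. Moreover, $g$ belongs to the Eremenko–Lyubich class $\mathcal{B}$, i.e. the set of finite singularities of $g^{-1}$ (the finite critical values and finite asymptotic values of $g$, together with their finite limit points) is bounded, and $\infty$ is not an asymptotic value of $g$. Here $a\in\mathbb{C}\cup\{\infty\}$ is an asymptotic value of $g$ if there is a curve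 $\gamma:[0,\infty)\to\mathbb{C}$ with $\gamma(t)\to\infty$ and $g(\gamma(t))\to a$ in the Riemann sphere as $t\to\infty$. -/

import Mathlib

open Filter Topology

noncomputable section

/-! ### Meromorphic functions on the plane, their critical and asymptotic values

A meromorphic function on the plane is represented by `f : ℂ → ℂ` with `Meromorphic f`. The values
of `f` on the discrete set of poles and removable singularities carry no information; the notions
below do not depend on them. -/

/-- The value at `z` of the meromorphic function `f`, as a point of the Riemann sphere: `∞` if
`z` is a pole, and the value of the analytic continuation of `f` into `z` otherwise. -/
def sphereValue (f : ℂ → ℂ) (z : ℂ) : OnePoint ℂ :=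
  open Classical in
  if meromorphicOrderAt f z < 0 then OnePoint.infty else ((toMeromorphicNFAt f z z : ℂ) : OnePoint ℂ)

/-- The finite critical values of the meromorphic function `f`: the values at those points, not
poles, where the derivative vanishes (removable singularities being filled in). -/
def finiteCriticalValues (f : ℂ → ℂ) : Set ℂ :=
  {w | ∃ z : ℂ, 0 ≤ meromorphicOrderAt f z ∧ deriv (toMeromorphicNFAt f z) z = 0 ∧
    toMeromorphicNFAt f z z = w}

/-- `a`, a point of the Riemann sphere, is an asymptotic value of the meromorphic function `f`:
there is a curve `γ : [0, ∞) → ℂ` tending to infinity along which `f` tends to `a`. -/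
def IsAsymptoticValue (f : ℂ → ℂ) (a : OnePoint ℂ) : Prop :=
  ∃ γ : ℝ → ℂ, ContinuousOn γ (Set.Ici 0) ∧ Tendsto (fun t => ‖γ t‖) atTop atTop ∧
    Tendsto (fun t => sphereValue f (γ t)) atTop (𝓝 a)

/-- The set of finite singularities of the inverse function of the meromorphic function `f`: the
finite critical and asymptotic values together with their finite limit points. -/
def finiteSingularities (f : ℂ → ℂ) : Set ℂ :=
  closure (finiteCriticalValues f ∪ {a : ℂ | IsAsymptoticValue f (a : OnePoint ℂ)})

/-- The Eremenko-Lyubich class: meromorphic functions on the plane for which the set of finite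
singularities of the inverse function is bounded. -/
structure IsEremenkoLyubich (f : ℂ → ℂ) : Prop where
  meromorphic : Meromorphic f
  bounded : Bornology.IsBounded (finiteSingularities f)

/-- Locally uniform convergence on the plane of a series `∑ u j` of meromorphic functions: on every
compact set all but finitely many terms are holomorphic, and the series of these remaining terms
converges uniformly there. -/
def ConvergesLocallyUniformly (u : ℕ → ℂ → ℂ) : Prop :=
  ∀ K : Set ℂ, IsCompact K → ∃ N : ℕ, (∀ j, N ≤ j → AnalyticOnNhd ℂ (u j) K) ∧
    TendstoUniformlyOn (fun (m : ℕ) z => ∑ j ∈ Finset.range m, u (N + j) z)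
      (fun z => ∑' j : ℕ, u (N + j) z) atTop K

/-! ### The function `g` -/

/-- `p(t) = (logⁿ t) ^ (1 / ρ)`, where `logⁿ` is the `n`-th iterate of the logarithm; it is only
used for `t ≥ expⁿ 2`. -/
def pFun (n : ℕ) (ρ : ℝ) (t : ℝ) : ℝ := (Real.log^[n] t) ^ (1 / ρ)

/-- `k₀ = ⌊expⁿ 2⌋ + 1`, where `expⁿ` is the `n`-th iterate of the exponential function. -/
def kZero (n : ℕ) : ℕ := ⌊Real.exp^[n] 2⌋₊ + 1

/-- `n_k = ⌊p(k) / p'(k)⌋`. -/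
def nSeq (n : ℕ) (ρ : ℝ) (k : ℕ) : ℕ := ⌊pFun n ρ k / deriv (pFun n ρ) k⌋₊

/-- The function `p(k) ^ n_k * z ^ n_k / (z ^ (2 n_k) - p(k) ^ (2 n_k))`. If `n_k = 0`, which for
small `ρ` happens for finitely many `k`, the formula is meaningless (the denominator is identically
zero), and the term is omitted, that is, taken to be zero. -/
def gTerm (n : ℕ) (ρ : ℝ) (k : ℕ) (z : ℂ) : ℂ :=
  if nSeq n ρ k = 0 then 0
  else ((pFun n ρ k : ℝ) : ℂ) ^ nSeq n ρ k * z ^ nSeq n ρ k /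
    (z ^ (2 * nSeq n ρ k) - ((pFun n ρ k : ℝ) : ℂ) ^ (2 * nSeq n ρ k))

/-- `g(z) = 2 ∑_{k = k₀ + 1}^∞ p(k) ^ n_k * z ^ n_k / (z ^ (2 n_k) - p(k) ^ (2 n_k))`. -/
def gFun (n : ℕ) (ρ : ℝ) (z : ℂ) : ℂ :=
  2 * ∑' j : ℕ, gTerm n ρ (kZero n + 1 + j) z

end

noncomputable section

/-! ### Iterated logarithms -/

/-! With `a = z ^ n_k`, `b = p(k) ^ n_k`, the `k`-th term is `T_k = ab / (a² - b²)`. Its poles lie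
on `‖z‖ = p(k)`, and it decays exponentially in `n_k |log ‖z‖ - log p(k)|`. Since `(log p)' = p' /
p` and `n_k` is the integer part of `p / p'` at `k`, moving the argument of `p` by one near `k`
changes `n_k log p` by an amount comparable to 1. Hence, on the annulus `p(m - 1/2) ≤ ‖z‖ ≤ p(m +
1/2)`, the terms with `k ≠ m` are dominated by a constant times `exp(-c|k - m|) + exp(-ck)`. Their
sum is at most `M = majorantSum n`, independently of `m` (`norm_gTerm_le_majorant`,
`norm_remainder_le`). So `g = 2 (T_m + R)` there with `‖R‖ ≤ M`; on a disc, the same majorants give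
convergence.

Asymptotic values: on the circles `‖z‖ = p(m + 1/2)` with `m > k₀`, also `‖T_m‖ ≤ M`, so `‖g‖ ≤ 4M`.
Every curve to infinity meets such circles at arbitrarily late times, so every asymptotic value lies
in the closed disc of radius `4M`; in particular none is infinite.

Critical values: `T_m' = -T_m q n_m / z` with `q² = 1 + 4 T_m²`, so `T_m'` is large where `T_m` is
large. There `z` is so near `‖z‖ = p(m)` that a disc of radius comparable to `‖z‖ / n_m` fits in the
annulus, and Cauchy's estimate bounds `R'` by a multiple of `M n_m / ‖z‖`. Thus `g' = 0` forces a
uniform bound on `T_m`, hence on `g`. -/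

theorem two_le_iterate_exp_two (n : ℕ) : 2 ≤ Real.exp^[n] 2 := by
  induction n with
  | zero => simp
  | succ n ih =>
    rw [Function.iterate_succ_apply']
    linarith [Real.add_one_le_exp (Real.exp^[n] 2)]

theorem two_le_iterate_log {n : ℕ} {t : ℝ} (ht : Real.exp^[n] 2 ≤ t) {i : ℕ} (hi : i ≤ n) :
    2 ≤ Real.log^[i] t := by
  induction n generalizing t i with
  | zero =>
    obtain rfl : i = 0 := by omega
    simpa using ht
  | succ n ih =>
    cases i with
    | zero => exact (two_le_iterate_exp_two _).trans ht
    | succ i =>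
      rw [Function.iterate_succ_apply]
      refine ih ?_ (by omega)
      rw [Function.iterate_succ_apply'] at ht
      exact (Real.le_log_iff_exp_le ((Real.exp_pos _).trans_le ht)).2 ht

theorem iterate_log_pos {n : ℕ} {t : ℝ} (ht : Real.exp^[n] 2 ≤ t) {i : ℕ} (hi : i ≤ n) :
    0 < Real.log^[i] t := by
  linarith [two_le_iterate_log ht hi]

theorem iterate_log_le_iterate_log {n : ℕ} {s t : ℝ} (hs : Real.exp^[n] 2 ≤ s) (hst : s ≤ t)
    {i : ℕ} (hi : i ≤ n) : Real.log^[i] s ≤ Real.log^[i] t := by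
  induction i with
  | zero => simpa
  | succ i ih =>
    simp only [Function.iterate_succ_apply']
    exact Real.log_le_log (iterate_log_pos hs (by omega)) (ih (by omega))

theorem iterate_log_two_mul_le {n : ℕ} {t : ℝ} (ht : Real.exp^[n] 2 ≤ t) {i : ℕ} (hi : i ≤ n) :
    Real.log^[i] (2 * t) ≤ 2 * Real.log^[i] t := by
  have h2 : t ≤ 2 * t := by linarith [two_le_iterate_exp_two n]
  induction i with
  | zero => simp
  | succ i ih =>
    have h0 := two_le_iterate_log ht hi
    rw [Function.iterate_succ_apply'] at h0
    simp only [Function.iterate_succ_apply']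
    have h := Real.log_le_log (iterate_log_pos (ht.trans h2) (by omega : i ≤ n)) (ih (by omega))
    rw [Real.log_mul (by norm_num) (iterate_log_pos ht (by omega : i ≤ n)).ne'] at h
    linarith [Real.log_two_lt_d9]

theorem hasDerivAt_iterate_log {n : ℕ} {t : ℝ} (ht : Real.exp^[n] 2 ≤ t) {i : ℕ}
    (hi : i ≤ n + 1) :
    HasDerivAt Real.log^[i] (∏ j ∈ Finset.range i, Real.log^[j] t)⁻¹ t := by
  induction i with
  | zero => simpa using hasDerivAt_id t
  | succ i ih =>
    rw [Function.iterate_succ', Finset.prod_range_succ, mul_inv, mul_comm]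
    exact (Real.hasDerivAt_log (iterate_log_pos ht (by omega : i ≤ n)).ne').comp t (ih (by omega))

/-! ### The logarithm of `p` -/

/-- The logarithm of `pFun n ρ`. -/
def logP (n : ℕ) (ρ t : ℝ) : ℝ := 1 / ρ * Real.log^[n + 1] t

/-- The reciprocal of the derivative of `logP n ρ`, that is, `p / p'`. -/
def ratioP (n : ℕ) (ρ t : ℝ) : ℝ := ρ * ∏ i ∈ Finset.range (n + 1), Real.log^[i] t

theorem pFun_eq_exp {n : ℕ} {ρ t : ℝ} (ht : Real.exp^[n] 2 ≤ t) :
    pFun n ρ t = Real.exp (logP n ρ t) := by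
  rw [pFun, logP, Real.rpow_def_of_pos (iterate_log_pos ht le_rfl), Function.iterate_succ_apply',
    mul_comm]

theorem hasDerivAt_logP {n : ℕ} {ρ t : ℝ} (ht : Real.exp^[n] 2 ≤ t) :
    HasDerivAt (logP n ρ) (ratioP n ρ t)⁻¹ t := by
  have := (hasDerivAt_iterate_log ht le_rfl).const_mul (1 / ρ)
  rw [ratioP, mul_inv, ← one_div ρ]
  exact this

theorem tendsto_logP {n : ℕ} {ρ : ℝ} (hρ : 0 < ρ) : Tendsto (logP n ρ) atTop atTop :=
  (Real.tendsto_log_atTop.iterate (n + 1)).const_mul_atTop (by positivity)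

theorem ratioP_pos {n : ℕ} {ρ t : ℝ} (hρ : 0 < ρ) (ht : Real.exp^[n] 2 ≤ t) :
    0 < ratioP n ρ t :=
  mul_pos hρ (Finset.prod_pos fun i hi => iterate_log_pos ht (by
    have := Finset.mem_range.1 hi; omega))

theorem ratioP_le_ratioP {n : ℕ} {ρ s t : ℝ} (hρ : 0 < ρ) (hs : Real.exp^[n] 2 ≤ s)
    (hst : s ≤ t) : ratioP n ρ s ≤ ratioP n ρ t := by
  refine mul_le_mul_of_nonneg_left (Finset.prod_le_prod (fun i hi => ?_) fun i hi => ?_) hρ.le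
  · exact (iterate_log_pos hs (by have := Finset.mem_range.1 hi; omega)).le
  · exact iterate_log_le_iterate_log hs hst (by have := Finset.mem_range.1 hi; omega)

/-- Each of the `n + 1` iterated logarithms at most doubles when `t` does. -/
theorem ratioP_two_mul_le {n : ℕ} {ρ t : ℝ} (hρ : 0 < ρ) (ht : Real.exp^[n] 2 ≤ t) :
    ratioP n ρ (2 * t) ≤ 2 ^ (n + 1) * ratioP n ρ t := by
  have h2 : t ≤ 2 * t := by linarith [two_le_iterate_exp_two n]
  have h : ∏ i ∈ Finset.range (n + 1), Real.log^[i] (2 * t) ≤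
      ∏ i ∈ Finset.range (n + 1), 2 * Real.log^[i] t := by
    refine Finset.prod_le_prod (fun i hi => ?_) fun i hi => ?_
    · exact (iterate_log_pos (ht.trans h2) (by have := Finset.mem_range.1 hi; omega)).le
    · exact iterate_log_two_mul_le ht (by have := Finset.mem_range.1 hi; omega)
  rw [Finset.prod_mul_distrib, Finset.prod_const, Finset.card_range] at h
  calc ratioP n ρ (2 * t) ≤ ρ * (2 ^ (n + 1) * ∏ i ∈ Finset.range (n + 1), Real.log^[i] t) :=
        mul_le_mul_of_nonneg_left h hρ.le
    _ = _ := by rw [ratioP]; ring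

theorem div_ratioP_le_logP_sub {n : ℕ} {ρ s t : ℝ} (hρ : 0 < ρ) (hs : Real.exp^[n] 2 ≤ s)
    (hst : s ≤ t) : (t - s) / ratioP n ρ t ≤ logP n ρ t - logP n ρ s := by
  rcases hst.eq_or_lt with rfl | hlt
  · simp
  obtain ⟨x, hx, hxe⟩ := exists_hasDerivAt_eq_slope (logP n ρ) (fun x => (ratioP n ρ x)⁻¹) hlt
    (fun x hx => (hasDerivAt_logP (hs.trans hx.1)).continuousAt.continuousWithinAt)
    (fun x hx => hasDerivAt_logP (hs.trans hx.1.le))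
  have h1 : (ratioP n ρ t)⁻¹ ≤ (ratioP n ρ x)⁻¹ :=
    inv_anti₀ (ratioP_pos hρ (hs.trans hx.1.le)) (ratioP_le_ratioP hρ (hs.trans hx.1.le) hx.2.le)
  rw [hxe, le_div_iff₀ (sub_pos.2 hlt)] at h1
  rw [div_eq_inv_mul]
  exact h1

theorem logP_le_logP {n : ℕ} {ρ s t : ℝ} (hρ : 0 < ρ) (hs : Real.exp^[n] 2 ≤ s)
    (hst : s ≤ t) : logP n ρ s ≤ logP n ρ t := by
  have := div_nonneg (sub_nonneg.2 hst) (ratioP_pos hρ (hs.trans hst)).le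
  linarith [div_ratioP_le_logP_sub hρ hs hst]

/-- The constant governing the separation of the circles `‖z‖ = p(k)` on the scale `1 / n_k`. -/
def sepConst (n : ℕ) : ℝ := 1 / 2 ^ (n + 2)

theorem sepConst_pos (n : ℕ) : 0 < sepConst n := by unfold sepConst; positivity

theorem sepConst_le (n : ℕ) : sepConst n ≤ 1 / 4 := by
  unfold sepConst
  refine one_div_le_one_div_of_le (by norm_num) ?_
  calc (4 : ℝ) = 2 ^ 2 := by norm_num
    _ ≤ 2 ^ (n + 2) := pow_le_pow_right₀ (by norm_num) (by omega)

/-- By the mean value theorem the increment of `logP` from `k` to `u` is at least `(u - k) / ratioP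
n ρ u`. The doubling bound controls `ratioP` only up to `2 * k`; beyond that, monotonicity of `logP`
is used, which explains the minimum. -/
theorem sepConst_mul_min_le_of_le {n : ℕ} {ρ k s ν : ℝ} (hρ : 0 < ρ) (hk : Real.exp^[n] 2 ≤ k)
    (hks : k ≤ s) (hν : ratioP n ρ k / 2 ≤ ν) :
    sepConst n * min (s - k) k ≤ ν * (logP n ρ s - logP n ρ k) := by
  have hk0 : 0 < k := by linarith [two_le_iterate_exp_two n]
  have hq := ratioP_pos hρ hk
  obtain ⟨u, hku, hus, hu2, hmin⟩ : ∃ u, k ≤ u ∧ u ≤ s ∧ u ≤ 2 * k ∧ min (s - k) k = u - k := by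
    rcases le_total s (2 * k) with h | h
    · exact ⟨s, hks, le_rfl, h, min_eq_left (by linarith)⟩
    · exact ⟨2 * k, by linarith, h, le_rfl, by rw [min_eq_right (by linarith)]; ring⟩
  have hqu := ratioP_pos hρ (hk.trans hku)
  have h1 : ratioP n ρ u ≤ 2 ^ (n + 1) * ratioP n ρ k :=
    (ratioP_le_ratioP hρ (hk.trans hku) hu2).trans (ratioP_two_mul_le hρ hk)
  have h2 := div_ratioP_le_logP_sub hρ hk hku
  have h3 := logP_le_logP hρ (hk.trans hku) hus
  -- The factor `2 ^ (n + 2)` is `2 ^ (n + 1)` from doubling times 2 from rounding the exponent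
  -- down.
  have h4 : sepConst n ≤ ν / ratioP n ρ u := by
    rw [sepConst, div_le_div_iff₀ (by positivity) hqu, pow_succ]
    nlinarith [pow_pos (two_pos (α := ℝ)) (n + 1)]
  rw [hmin]
  calc sepConst n * (u - k) ≤ ν / ratioP n ρ u * (u - k) :=
        mul_le_mul_of_nonneg_right h4 (by linarith)
    _ = ν * ((u - k) / ratioP n ρ u) := by ring
    _ ≤ ν * (logP n ρ s - logP n ρ k) := by
        refine mul_le_mul_of_nonneg_left ?_ (by linarith)
        linarith

/-- To the left of `k`, `ratioP` is largest at `k` itself, so no doubling and no minimum are needed.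
-/
theorem sepConst_mul_le_of_le {n : ℕ} {ρ k s ν : ℝ} (hρ : 0 < ρ) (hs : Real.exp^[n] 2 ≤ s)
    (hsk : s ≤ k) (hν : ratioP n ρ k / 2 ≤ ν) :
    sepConst n * (k - s) ≤ ν * (logP n ρ k - logP n ρ s) := by
  have hq := ratioP_pos hρ (hs.trans hsk)
  have h2 := div_ratioP_le_logP_sub hρ hs hsk
  calc sepConst n * (k - s) ≤ 1 / 2 * (k - s) :=
        mul_le_mul_of_nonneg_right (by linarith [sepConst_le n]) (by linarith)
    _ = ratioP n ρ k / 2 * ((k - s) / ratioP n ρ k) := by field_simp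
    _ ≤ ν * (logP n ρ k - logP n ρ s) := by
        refine mul_le_mul hν h2 (div_nonneg (by linarith) hq.le) (by linarith)

/-! ### The exponents `n_k` -/

theorem iterate_exp_lt_kZero (n : ℕ) : Real.exp^[n] 2 < kZero n := by
  rw [kZero]
  push_cast
  exact Nat.lt_floor_add_one _

theorem nSeq_eq {n : ℕ} {ρ : ℝ} {k : ℕ} (hk : kZero n ≤ k) :
    nSeq n ρ k = ⌊ratioP n ρ k⌋₊ := by
  have hlt : Real.exp^[n] 2 < k := (iterate_exp_lt_kZero n).trans_le (by exact_mod_cast hk)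
  have h : HasDerivAt (pFun n ρ) (Real.exp (logP n ρ k) * (ratioP n ρ k)⁻¹) k := by
    -- The strict inequality `hlt` makes `pFun` agree with `exp ∘ logP` on a whole neighbourhood of
    -- `k`.
    refine (hasDerivAt_logP hlt.le).exp.congr_of_eventuallyEq ?_
    filter_upwards [Ioi_mem_nhds hlt] with t ht using pFun_eq_exp (le_of_lt ht)
  rw [nSeq, h.deriv, pFun_eq_exp hlt.le, div_mul_cancel_left₀ (Real.exp_pos _).ne', inv_inv]

theorem ratioP_div_two_le_nSeq {n : ℕ} {ρ : ℝ} {k : ℕ} (hk : kZero n ≤ k)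
    (h0 : nSeq n ρ k ≠ 0) : ratioP n ρ k / 2 ≤ nSeq n ρ k := by
  have h1 : (1 : ℝ) ≤ nSeq n ρ k := by exact_mod_cast Nat.one_le_iff_ne_zero.2 h0
  have h2 := Nat.lt_floor_add_one (ratioP n ρ k)
  rw [← nSeq_eq hk] at h2
  linarith

/-! ### Bounds for the terms -/

theorem norm_mul_div_sq_sub_sq_le {a b : ℂ} {y : ℝ} (hy0 : 0 ≤ y) (hy : y < 1) (hb : b ≠ 0)
    (hab : ‖a‖ ≤ y * ‖b‖) : ‖a * b / (a ^ 2 - b ^ 2)‖ ≤ y / (1 - y ^ 2) := by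
  have hb0 : 0 < ‖b‖ := norm_pos_iff.2 hb
  have hy2 : 0 < 1 - y ^ 2 := by nlinarith
  have h1 : (1 - y ^ 2) * ‖b‖ ^ 2 ≤ ‖a ^ 2 - b ^ 2‖ := by
    have h := norm_sub_norm_le (b ^ 2) (a ^ 2)
    rw [norm_sub_rev, norm_pow, norm_pow] at h
    have : ‖a‖ ^ 2 ≤ (y * ‖b‖) ^ 2 := pow_le_pow_left₀ (norm_nonneg _) hab 2
    nlinarith
  rw [norm_div, norm_mul]
  calc ‖a‖ * ‖b‖ / ‖a ^ 2 - b ^ 2‖ ≤ y * ‖b‖ * ‖b‖ / ((1 - y ^ 2) * ‖b‖ ^ 2) := by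
        gcongr
    _ = y / (1 - y ^ 2) := by field_simp

theorem norm_mul_div_sq_sub_sq_le' {a b : ℂ} {y : ℝ} (hy0 : 0 ≤ y) (hy : y < 1) (ha : a ≠ 0)
    (hab : ‖b‖ ≤ y * ‖a‖) : ‖a * b / (a ^ 2 - b ^ 2)‖ ≤ y / (1 - y ^ 2) := by
  have h := norm_mul_div_sq_sub_sq_le hy0 hy ha hab
  rwa [mul_comm b a, ← neg_sub, div_neg, norm_neg] at h

theorem gTerm_eq {n : ℕ} {ρ : ℝ} {k : ℕ} (h0 : nSeq n ρ k ≠ 0) (z : ℂ) :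
    gTerm n ρ k z = z ^ nSeq n ρ k * ((pFun n ρ k : ℝ) : ℂ) ^ nSeq n ρ k /
      ((z ^ nSeq n ρ k) ^ 2 - (((pFun n ρ k : ℝ) : ℂ) ^ nSeq n ρ k) ^ 2) := by
  rw [gTerm, if_neg h0, mul_comm, mul_comm 2, pow_mul, pow_mul]

theorem exp_le_iterate {n k : ℕ} (hk : kZero n ≤ k) : Real.exp^[n] 2 ≤ k :=
  (iterate_exp_lt_kZero n).le.trans (by exact_mod_cast hk)

theorem norm_gTerm_le_of_norm_le {n : ℕ} {ρ s L : ℝ} {k : ℕ} {z : ℂ} (hk : kZero n ≤ k)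
    (hL : 0 < L) (hz : ‖z‖ ≤ Real.exp s) (hLs : nSeq n ρ k ≠ 0 → L ≤ nSeq n ρ k * (logP n ρ k - s)) :
    ‖gTerm n ρ k z‖ ≤ Real.exp (-L) / (1 - Real.exp (-L) ^ 2) := by
  have hy : Real.exp (-L) < 1 := by simpa using hL
  by_cases h0 : nSeq n ρ k = 0
  · rw [gTerm, if_pos h0, norm_zero]
    exact div_nonneg (Real.exp_pos _).le (by nlinarith [Real.exp_pos (-L)])
  rw [gTerm_eq h0, pFun_eq_exp (exp_le_iterate hk)]
  refine norm_mul_div_sq_sub_sq_le (Real.exp_pos _).le hy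
    (pow_ne_zero _ (by exact_mod_cast (Real.exp_pos _).ne')) ?_
  rw [norm_pow, norm_pow, Complex.norm_real, Real.norm_of_nonneg (Real.exp_pos _).le,
    ← Real.exp_nat_mul, ← Real.exp_add]
  calc ‖z‖ ^ nSeq n ρ k ≤ Real.exp s ^ nSeq n ρ k := pow_le_pow_left₀ (norm_nonneg _) hz _
    _ = Real.exp (nSeq n ρ k * s) := (Real.exp_nat_mul _ _).symm
    _ ≤ _ := Real.exp_le_exp.2 (by linarith [hLs h0])

theorem norm_gTerm_le_of_le_norm {n : ℕ} {ρ s L : ℝ} {k : ℕ} {z : ℂ} (hk : kZero n ≤ k)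
    (hL : 0 < L) (hz : Real.exp s ≤ ‖z‖) (hLs : nSeq n ρ k ≠ 0 → L ≤ nSeq n ρ k * (s - logP n ρ k)) :
    ‖gTerm n ρ k z‖ ≤ Real.exp (-L) / (1 - Real.exp (-L) ^ 2) := by
  have hy : Real.exp (-L) < 1 := by simpa using hL
  by_cases h0 : nSeq n ρ k = 0
  · rw [gTerm, if_pos h0, norm_zero]
    exact div_nonneg (Real.exp_pos _).le (by nlinarith [Real.exp_pos (-L)])
  rw [gTerm_eq h0, pFun_eq_exp (exp_le_iterate hk)]
  refine norm_mul_div_sq_sub_sq_le' (Real.exp_pos _).le hy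
    (pow_ne_zero _ (norm_pos_iff.1 ((Real.exp_pos s).trans_le hz))) ?_
  rw [norm_pow, norm_pow, Complex.norm_real, Real.norm_of_nonneg (Real.exp_pos _).le,
    ← Real.exp_nat_mul]
  calc Real.exp (nSeq n ρ k * logP n ρ k) ≤ Real.exp (-L + nSeq n ρ k * s) :=
        Real.exp_le_exp.2 (by linarith [hLs h0])
    _ = Real.exp (-L) * Real.exp s ^ nSeq n ρ k := by rw [Real.exp_add, Real.exp_nat_mul]
    _ ≤ _ := by gcongr

/-- A bound for the term of index `k` on the annulus of index `m`. -/
def majorant (n m k : ℕ) : ℝ :=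
  1 / (1 - Real.exp (-sepConst n)) * (Real.exp (-(sepConst n * k)) +
    Real.exp (sepConst n / 2) * Real.exp (-(sepConst n * |(k - m : ℤ)|)))

theorem exp_neg_sepConst_lt_one (n : ℕ) : Real.exp (-sepConst n) < 1 := by
  simpa using sepConst_pos n

theorem majorant_nonneg (n m k : ℕ) : 0 ≤ majorant n m k :=
  mul_nonneg (one_div_nonneg.2 (by linarith [exp_neg_sepConst_lt_one n])) (by positivity)

theorem exp_div_le_majorant {n m k : ℕ} {L : ℝ} (hkm : k ≠ m) (hk : 0 < k)
    (hL : L = sepConst n * min (((|(k - m : ℤ)| : ℤ) : ℝ) - 1 / 2) k) :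
    0 < L ∧ Real.exp (-L) / (1 - Real.exp (-L) ^ 2) ≤ majorant n m k := by
  have hc := sepConst_pos n
  have hd : (1 : ℝ) ≤ |(k - m : ℤ)| := by
    have : (1 : ℤ) ≤ |(k - m : ℤ)| := Int.one_le_abs (by omega)
    exact_mod_cast this
  have hk1 : (1 : ℝ) ≤ k := by exact_mod_cast hk
  have hmin : 1 / 2 ≤ min (((|(k - m : ℤ)| : ℤ) : ℝ) - 1 / 2) k :=
    le_min (by linarith) (by linarith)
  -- This keeps the denominator `1 - exp(-L) ^ 2` away from 0, uniformly in `k` and `m`. The minimum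
  -- in `L` is then handled by adding both exponentials.
  have hL2 : sepConst n / 2 ≤ L := by rw [hL]; nlinarith
  refine ⟨by linarith, ?_⟩
  have h1 : Real.exp (-L) ^ 2 ≤ Real.exp (-sepConst n) := by
    rw [← Real.exp_nat_mul]
    exact Real.exp_le_exp.2 (by push_cast; linarith)
  have h2 : Real.exp (-L) ≤ Real.exp (-(sepConst n * k)) +
      Real.exp (sepConst n / 2) * Real.exp (-(sepConst n * |(k - m : ℤ)|)) := by
    rw [← Real.exp_add, hL]
    rcases min_choice (((|(k - m : ℤ)| : ℤ) : ℝ) - 1 / 2) (k : ℝ) with h | h <;> rw [h]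
    · have : -(sepConst n * (((|(k - m : ℤ)| : ℤ) : ℝ) - 1 / 2)) =
          sepConst n / 2 + -(sepConst n * |(k - m : ℤ)|) := by ring
      rw [this]
      linarith [Real.exp_pos (-(sepConst n * k))]
    · linarith [Real.exp_pos (sepConst n / 2 + -(sepConst n * |(k - m : ℤ)|))]
  have h3 := exp_neg_sepConst_lt_one n
  rw [majorant, one_div_mul_eq_div]
  exact div_le_div₀ (by positivity) h2 (by linarith) (by linarith)

theorem iterate_exp_le_add_half {n m : ℕ} (hm : kZero n ≤ m) :
    Real.exp^[n] 2 ≤ (m : ℝ) + 1 / 2 := by linarith [exp_le_iterate hm]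

theorem iterate_exp_le_sub_half {n m : ℕ} (hm : kZero n < m) :
    Real.exp^[n] 2 ≤ (m : ℝ) - 1 / 2 := by
  have : (kZero n : ℝ) + 1 ≤ m := by exact_mod_cast hm
  linarith [iterate_exp_lt_kZero n]

theorem norm_gTerm_le_majorant_of_lt {n : ℕ} {ρ : ℝ} (hρ : 0 < ρ) {m k : ℕ} (hm : kZero n ≤ m)
    (hmk : m < k) {z : ℂ} (hz : ‖z‖ ≤ pFun n ρ (m + 1 / 2)) :
    ‖gTerm n ρ k z‖ ≤ majorant n m k := by
  have hkm : (m : ℝ) + 1 ≤ k := by exact_mod_cast hmk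
  obtain ⟨h1, h2⟩ := exp_div_le_majorant (n := n) hmk.ne' (by omega : 0 < k) rfl
  rw [pFun_eq_exp (iterate_exp_le_add_half hm)] at hz
  refine (norm_gTerm_le_of_norm_le (by omega) h1 hz fun h0 => ?_).trans h2
  refine le_trans (mul_le_mul_of_nonneg_left (min_le_left _ _) (sepConst_pos n).le) ?_
  rw [abs_of_nonneg (by omega)]
  push_cast
  refine le_trans (le_of_eq (by ring)) (sepConst_mul_le_of_le hρ (iterate_exp_le_add_half hm)
    (by linarith) (ratioP_div_two_le_nSeq (by omega) h0))

theorem norm_gTerm_le_majorant_of_gt {n : ℕ} {ρ : ℝ} (hρ : 0 < ρ) {m k : ℕ} (hk : kZero n ≤ k)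
    (hmk : k < m) {z : ℂ} (hz : pFun n ρ (m - 1 / 2) ≤ ‖z‖) :
    ‖gTerm n ρ k z‖ ≤ majorant n m k := by
  have hkm : (k : ℝ) + 1 ≤ m := by exact_mod_cast hmk
  have hk0 : 0 < k := lt_of_lt_of_le (Nat.succ_pos _) hk
  obtain ⟨h1, h2⟩ := exp_div_le_majorant (n := n) hmk.ne hk0 rfl
  rw [pFun_eq_exp (iterate_exp_le_sub_half (by omega))] at hz
  refine (norm_gTerm_le_of_le_norm hk h1 hz fun h0 => ?_).trans h2
  rw [abs_sub_comm, abs_of_nonneg (by omega)]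
  push_cast
  refine le_trans (le_of_eq ?_) (sepConst_mul_min_le_of_le hρ (exp_le_iterate hk)
    (by linarith) (ratioP_div_two_le_nSeq hk h0))
  congr 2
  ring_nf

theorem summable_exp_neg_mul_abs {c : ℝ} (hc : 0 < c) :
    Summable fun i : ℤ => Real.exp (-(c * |i|)) := by
  have h : Summable fun i : ℕ => Real.exp (-(c * i)) := by
    have := Real.summable_exp_nat_mul_iff.2 (neg_lt_zero.2 hc)
    refine this.congr fun i => by ring_nf
  refine Summable.of_nat_of_neg ?_ ?_ <;> simpa using h

/-- A bound for the sums of `majorant n m`, independent of `m`. -/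
def majorantSum (n : ℕ) : ℝ :=
  1 / (1 - Real.exp (-sepConst n)) * (∑' k : ℕ, Real.exp (-(sepConst n * k)) +
    Real.exp (sepConst n / 2) * ∑' i : ℤ, Real.exp (-(sepConst n * |i|)))

theorem summable_majorant (n m : ℕ) : Summable (majorant n m) ∧
    ∑' k, majorant n m k ≤ majorantSum n := by
  have hi : Function.Injective fun k : ℕ => (k - m : ℤ) := fun a b h => by simpa using h
  have hZ := summable_exp_neg_mul_abs (sepConst_pos n)
  have h1 : Summable fun k : ℕ => Real.exp (-(sepConst n * k)) := by
    have := hZ.comp_injective Nat.cast_injective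
    simpa [Function.comp_def] using this
  have h2 : Summable fun k : ℕ => Real.exp (-(sepConst n * |(k - m : ℤ)|)) := hZ.comp_injective hi
  have h3 : ∑' k : ℕ, Real.exp (-(sepConst n * |(k - m : ℤ)|)) ≤
      ∑' i : ℤ, Real.exp (-(sepConst n * |i|)) :=
    tsum_comp_le_tsum_of_inj hZ (fun _ => (Real.exp_pos _).le) hi
  refine ⟨(h1.add (h2.mul_left _)).mul_left _, ?_⟩
  unfold majorant
  rw [tsum_mul_left, h1.tsum_add (h2.mul_left _), tsum_mul_left, majorantSum]
  refine mul_le_mul_of_nonneg_left ?_ (one_div_nonneg.2 (by linarith [exp_neg_sepConst_lt_one n]))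
  gcongr

/-! ### Series of meromorphic functions with local majorants -/

/-- On every disc, all but finitely many of the functions `u j` are holomorphic and they have a
summable majorant. -/
def HasLocalMajorants (u : ℕ → ℂ → ℂ) : Prop :=
  ∀ R : ℝ, ∃ (N : ℕ) (v : ℕ → ℝ), Summable v ∧ ∀ j,
    AnalyticOnNhd ℂ (u (N + j)) (Metric.closedBall 0 R) ∧
      ∀ z ∈ Metric.closedBall (0 : ℂ) R, ‖u (N + j) z‖ ≤ v j

namespace HasLocalMajorants

variable {u : ℕ → ℂ → ℂ}

theorem convergesLocallyUniformly (hu : HasLocalMajorants u) : ConvergesLocallyUniformly u := by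
  intro K hK
  obtain ⟨R, hR⟩ := hK.isBounded.subset_closedBall (0 : ℂ)
  obtain ⟨N, v, hv, h⟩ := hu R
  refine ⟨N, fun j hj => ?_, ?_⟩
  · obtain ⟨i, rfl⟩ := Nat.exists_eq_add_of_le hj
    exact (h i).1.mono hR
  · exact tendstoUniformlyOn_tsum_nat hv fun j z hz => (h j).2 z (hR hz)

theorem summable (hu : HasLocalMajorants u) (z : ℂ) : Summable fun j => u j z := by
  obtain ⟨N, v, hv, h⟩ := hu ‖z‖
  rw [← summable_nat_add_iff N]
  refine Summable.of_norm_bounded hv fun j => ?_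
  rw [add_comm]
  exact (h j).2 z (by simp)

theorem tsum_eventuallyEq (hu : HasLocalMajorants u) (z : ℂ) :
    ∃ (N : ℕ) (F : ℂ → ℂ), AnalyticAt ℂ F z ∧
      (fun w => ∑' j, u j w) =ᶠ[𝓝 z] (∑ j ∈ Finset.range N, u j) + F := by
  obtain ⟨N, v, hv, h⟩ := hu (‖z‖ + 1)
  have hz : Metric.ball (0 : ℂ) (‖z‖ + 1) ∈ 𝓝 z := Metric.isOpen_ball.mem_nhds (by simp)
  refine ⟨N, fun w => ∑' j, u (N + j) w, ?_, Eventually.of_forall fun w => ?_⟩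
  · refine DifferentiableOn.analyticAt (Complex.differentiableOn_tsum_of_summable_norm hv
      (fun j => ((h j).1.mono Metric.ball_subset_closedBall).differentiableOn) Metric.isOpen_ball
      fun j w hw => (h j).2 w (Metric.ball_subset_closedBall hw)) hz
  · have := (hu.summable w).sum_add_tsum_nat_add N
    simp only [Pi.add_apply, Finset.sum_apply, ← this, add_comm]

theorem analyticAt_tsum (hu : HasLocalMajorants u) {z : ℂ} (h : ∀ j, AnalyticAt ℂ (u j) z) :
    AnalyticAt ℂ (fun w => ∑' j, u j w) z := by
  obtain ⟨N, F, hF, hE⟩ := hu.tsum_eventuallyEq z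
  exact ((Finset.analyticAt_sum _ fun j _ => h j).add hF).congr hE.symm

theorem meromorphic_tsum (hu : HasLocalMajorants u) (h : ∀ j, Meromorphic (u j)) :
    Meromorphic (fun w => ∑' j, u j w) := by
  intro z
  obtain ⟨N, F, hF, hE⟩ := hu.tsum_eventuallyEq z
  exact ((MeromorphicAt.sum fun j _ => h j z).add hF.meromorphicAt).congr
    (hE.symm.filter_mono nhdsWithin_le_nhds)

theorem erase (hu : HasLocalMajorants u) (i : ℕ) :
    HasLocalMajorants fun j z => if j = i then 0 else u j z := by
  intro R
  obtain ⟨N, v, hv, h⟩ := hu R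
  refine ⟨N, v, hv, fun j => ?_⟩
  by_cases hj : N + j = i
  · simp only [hj, if_true]
    exact ⟨analyticOnNhd_const, fun z hz => by simpa using (norm_nonneg _).trans ((h j).2 z hz)⟩
  · simpa only [hj, if_false] using h j

end HasLocalMajorants

/-! ### Analyticity of the terms -/

theorem meromorphic_gTerm (n : ℕ) (ρ : ℝ) (k : ℕ) : Meromorphic (gTerm n ρ k) := by
  intro z
  by_cases h0 : nSeq n ρ k = 0
  · have : gTerm n ρ k = fun _ => 0 := by ext z; rw [gTerm, if_pos h0]
    rw [this]; exact MeromorphicAt.const 0 z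
  · have : gTerm n ρ k = _ := funext (gTerm_eq h0)
    rw [this]; fun_prop

theorem analyticAt_gTerm {n : ℕ} {ρ : ℝ} {k : ℕ} {z : ℂ} (h : nSeq n ρ k ≠ 0 →
    (z ^ nSeq n ρ k) ^ 2 ≠ (((pFun n ρ k : ℝ) : ℂ) ^ nSeq n ρ k) ^ 2) :
    AnalyticAt ℂ (gTerm n ρ k) z := by
  by_cases h0 : nSeq n ρ k = 0
  · have : gTerm n ρ k = fun _ => 0 := by ext z; rw [gTerm, if_pos h0]
    rw [this]; exact analyticAt_const
  · have : gTerm n ρ k = _ := funext (gTerm_eq h0)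
    rw [this]
    exact AnalyticAt.fun_div (by fun_prop) (by fun_prop) (sub_ne_zero.2 (h h0))

theorem analyticAt_gTerm_of_norm_ne {n : ℕ} {ρ : ℝ} {k : ℕ} {z : ℂ} (hk : kZero n ≤ k)
    (h : ‖z‖ ≠ pFun n ρ k) : AnalyticAt ℂ (gTerm n ρ k) z := by
  refine analyticAt_gTerm fun h0 he => h ?_
  have hp : 0 < pFun n ρ k := by rw [pFun_eq_exp (exp_le_iterate hk)]; exact Real.exp_pos _
  rw [← pow_mul, ← pow_mul] at he
  have := congrArg norm he
  rw [norm_pow, norm_pow, Complex.norm_real, Real.norm_of_nonneg hp.le] at this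
  exact (pow_left_inj₀ (norm_nonneg _) hp.le (by positivity)).1 this

theorem pFun_lt_pFun {n : ℕ} {ρ s t : ℝ} (hρ : 0 < ρ) (hs : Real.exp^[n] 2 ≤ s) (hst : s < t) :
    pFun n ρ s < pFun n ρ t := by
  rw [pFun_eq_exp hs, pFun_eq_exp (hs.trans hst.le), Real.exp_lt_exp]
  have := div_pos (sub_pos.2 hst) (ratioP_pos hρ (hs.trans hst.le))
  linarith [div_ratioP_le_logP_sub hρ hs hst.le]

/-- The closed annulus around the circle `‖z‖ = p(m)`; for `m = k₀` it is a disc. -/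
def annulus (n : ℕ) (ρ : ℝ) (m : ℕ) : Set ℂ :=
  {z | ‖z‖ ≤ pFun n ρ (m + 1 / 2) ∧ (kZero n < m → pFun n ρ (m - 1 / 2) ≤ ‖z‖)}

theorem norm_gTerm_le_majorant {n : ℕ} {ρ : ℝ} (hρ : 0 < ρ) {m k : ℕ} (hm : kZero n ≤ m)
    (hk : kZero n ≤ k) (hmk : k ≠ m) {z : ℂ} (hz : z ∈ annulus n ρ m) :
    ‖gTerm n ρ k z‖ ≤ majorant n m k := by
  rcases hmk.lt_or_gt with h | h
  · exact norm_gTerm_le_majorant_of_gt hρ hk h (hz.2 (by omega))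
  · exact norm_gTerm_le_majorant_of_lt hρ hm h hz.1

theorem norm_lt_pFun {n : ℕ} {ρ : ℝ} (hρ : 0 < ρ) {m k : ℕ} (hm : kZero n ≤ m)
    (hmk : m < k) {z : ℂ} (hz : ‖z‖ ≤ pFun n ρ (m + 1 / 2)) : ‖z‖ < pFun n ρ k := by
  have : (m : ℝ) + 1 ≤ k := by exact_mod_cast hmk
  exact hz.trans_lt (pFun_lt_pFun hρ (iterate_exp_le_add_half hm) (by linarith))

theorem analyticAt_gTerm_of_mem_annulus {n : ℕ} {ρ : ℝ} (hρ : 0 < ρ) {m k : ℕ} (hm : kZero n ≤ m)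
    (hk : kZero n ≤ k) (hmk : k ≠ m) {z : ℂ} (hz : z ∈ annulus n ρ m) :
    AnalyticAt ℂ (gTerm n ρ k) z := by
  refine analyticAt_gTerm_of_norm_ne hk ?_
  rcases hmk.lt_or_gt with h | h
  · have : (k : ℝ) + 1 ≤ m := by exact_mod_cast h
    exact (lt_of_lt_of_le (pFun_lt_pFun hρ (exp_le_iterate hk) (by linarith))
      (hz.2 (by omega))).ne'
  · exact (norm_lt_pFun hρ hm h hz.1).ne

theorem tendsto_pFun {n : ℕ} {ρ : ℝ} (hρ : 0 < ρ) :
    Tendsto (fun m : ℕ => pFun n ρ (m + 1 / 2)) atTop atTop := by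
  have h1 : Tendsto (fun m : ℕ => (m : ℝ) + 1 / 2) atTop atTop :=
    tendsto_atTop_add_const_right _ _ tendsto_natCast_atTop_atTop
  refine (Real.tendsto_exp_atTop.comp ((tendsto_logP (n := n) hρ).comp h1)).congr' ?_
  filter_upwards [eventually_ge_atTop (kZero n)] with m hm
  exact (pFun_eq_exp (iterate_exp_le_add_half hm)).symm

theorem hasLocalMajorants_gTerm {n : ℕ} {ρ : ℝ} (hρ : 0 < ρ) :
    HasLocalMajorants fun j => gTerm n ρ (kZero n + 1 + j) := by
  intro R
  obtain ⟨m, hm, hR⟩ := ((eventually_ge_atTop (kZero n)).and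
    ((tendsto_pFun (n := n) hρ).eventually_ge_atTop R)).exists
  refine ⟨m, fun j => majorant n m (kZero n + 1 + (m + j)), ?_, fun j => ⟨fun z hz => ?_,
    fun z hz => ?_⟩⟩
  · exact (summable_majorant n m).1.comp_injective fun a b h => by simpa using h
  · refine analyticAt_gTerm_of_norm_ne (by omega) (norm_lt_pFun hρ hm (by omega) ?_).ne
    exact (mem_closedBall_zero_iff.1 hz).trans hR
  · exact norm_gTerm_le_majorant_of_lt hρ hm (by omega) ((mem_closedBall_zero_iff.1 hz).trans hR)

/-! ### Splitting off the dominant term -/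

/-- Half of `gFun n ρ` with the term of index `kZero n + 1 + i` left out. -/
def remainder (n : ℕ) (ρ : ℝ) (i : ℕ) (z : ℂ) : ℂ :=
  ∑' j, if j = i then 0 else gTerm n ρ (kZero n + 1 + j) z

theorem gFun_eq_add_remainder {n : ℕ} {ρ : ℝ} (hρ : 0 < ρ) (i : ℕ) (z : ℂ) :
    gFun n ρ z = 2 * (gTerm n ρ (kZero n + 1 + i) z + remainder n ρ i z) := by
  rw [gFun, remainder, ((hasLocalMajorants_gTerm hρ).summable z).tsum_eq_add_tsum_ite i]

theorem meromorphic_gFun {n : ℕ} {ρ : ℝ} (hρ : 0 < ρ) : Meromorphic (gFun n ρ) := fun z =>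
  (MeromorphicAt.const 2 z).mul
    ((hasLocalMajorants_gTerm hρ).meromorphic_tsum (fun _ => meromorphic_gTerm _ _ _) z)

theorem analyticAt_gFun {n : ℕ} {ρ : ℝ} (hρ : 0 < ρ) {z : ℂ}
    (h : ∀ k, kZero n < k → AnalyticAt ℂ (gTerm n ρ k) z) : AnalyticAt ℂ (gFun n ρ) z :=
  analyticAt_const.mul ((hasLocalMajorants_gTerm hρ).analyticAt_tsum fun j => h _ (by omega))

theorem analyticAt_remainder {n : ℕ} {ρ : ℝ} (hρ : 0 < ρ) {i : ℕ} {z : ℂ}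
    (hz : z ∈ annulus n ρ (kZero n + 1 + i)) : AnalyticAt ℂ (remainder n ρ i) z := by
  refine ((hasLocalMajorants_gTerm hρ).erase i).analyticAt_tsum fun j => ?_
  by_cases hj : j = i
  · simp only [hj, if_true]; exact analyticAt_const
  · simp only [hj, if_false]
    exact analyticAt_gTerm_of_mem_annulus hρ (by omega) (by omega) (by omega) hz

theorem norm_tsum_le_majorantSum {n : ℕ} (m : ℕ) {v : ℕ → ℂ}
    (hv : ∀ j, ‖v j‖ ≤ majorant n m (kZero n + 1 + j)) : ‖∑' j, v j‖ ≤ majorantSum n := by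
  have hi : Function.Injective fun j => kZero n + 1 + j := fun a b h => by simpa using h
  obtain ⟨h1, h2⟩ := summable_majorant n m
  exact (tsum_of_norm_bounded (h1.comp_injective hi).hasSum hv).trans
    ((tsum_comp_le_tsum_of_inj h1 (majorant_nonneg n m) hi).trans h2)

theorem norm_remainder_le {n : ℕ} {ρ : ℝ} (hρ : 0 < ρ) {i : ℕ} {z : ℂ}
    (hz : z ∈ annulus n ρ (kZero n + 1 + i)) : ‖remainder n ρ i z‖ ≤ majorantSum n := by
  refine norm_tsum_le_majorantSum (kZero n + 1 + i) fun j => ?_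
  by_cases hj : j = i
  · simp only [hj, if_true, norm_zero]; exact majorant_nonneg _ _ _
  · simp only [hj, if_false]
    exact norm_gTerm_le_majorant hρ (by omega) (by omega) (by omega) hz

theorem exists_mem_annulus {n : ℕ} {ρ : ℝ} (hρ : 0 < ρ) (z : ℂ) :
    ∃ m, kZero n ≤ m ∧ z ∈ annulus n ρ m := by
  classical
  have hex : ∃ m, kZero n ≤ m ∧ ‖z‖ ≤ pFun n ρ (m + 1 / 2) :=
    ((eventually_ge_atTop (kZero n)).and
      ((tendsto_pFun (n := n) hρ).eventually_ge_atTop ‖z‖)).exists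
  refine ⟨Nat.find hex, (Nat.find_spec hex).1, (Nat.find_spec hex).2, fun hlt => ?_⟩
  by_contra hcon
  have hpos : 1 ≤ Nat.find hex := by omega
  refine Nat.find_min hex (m := Nat.find hex - 1) (by omega) ⟨by omega, ?_⟩
  rw [Nat.cast_sub hpos, Nat.cast_one]
  rw [show (Nat.find hex : ℝ) - 1 + 1 / 2 = Nat.find hex - 1 / 2 by ring]
  exact (not_le.1 hcon).le

/-! ### Asymptotic values -/

theorem majorantSum_nonneg (n : ℕ) : 0 ≤ majorantSum n :=
  (tsum_nonneg (majorant_nonneg n 0)).trans (summable_majorant n 0).2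

theorem mem_annulus_of_norm_eq {n : ℕ} {ρ : ℝ} (hρ : 0 < ρ) {m : ℕ} (hm : kZero n ≤ m) {z : ℂ}
    (hz : ‖z‖ = pFun n ρ (m + 1 / 2)) : z ∈ annulus n ρ m ∧ z ∈ annulus n ρ (m + 1) := by
  have h0 := exp_le_iterate hm
  refine ⟨⟨hz.le, fun hlt => hz ▸ (pFun_lt_pFun hρ (iterate_exp_le_sub_half hlt)
    (by linarith)).le⟩, ⟨hz ▸ (pFun_lt_pFun hρ (by linarith) (by push_cast; linarith)).le,
    fun _ => ?_⟩⟩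
  rw [hz]
  push_cast
  rw [show (m : ℝ) + 1 - 1 / 2 = m + 1 / 2 by ring]

/-- The circle belongs to two adjacent annuli: the inner one bounds the remainder, while on the
outer one the term left out is no longer dominant and is bounded by its majorant. -/
theorem gFun_of_norm_eq {n : ℕ} {ρ : ℝ} (hρ : 0 < ρ) {i : ℕ} {z : ℂ}
    (hz : ‖z‖ = pFun n ρ ((kZero n + 1 + i : ℕ) + 1 / 2)) :
    AnalyticAt ℂ (gFun n ρ) z ∧ ‖gFun n ρ z‖ ≤ 4 * majorantSum n := by
  obtain ⟨h1, h2⟩ := mem_annulus_of_norm_eq hρ (by omega) hz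
  refine ⟨analyticAt_gFun hρ fun k hk => ?_, ?_⟩
  · by_cases hkm : k = kZero n + 1 + i
    · exact analyticAt_gTerm_of_mem_annulus hρ (by omega) hk.le (by omega) h2
    · exact analyticAt_gTerm_of_mem_annulus hρ (by omega) hk.le hkm h1
  · have h3 := norm_gTerm_le_majorant hρ (k := kZero n + 1 + i) (by omega) (by omega) (by omega) h2
    obtain ⟨h4, h5⟩ := summable_majorant n (kZero n + 1 + i + 1)
    have h6 := h4.le_tsum (kZero n + 1 + i) fun j _ => majorant_nonneg _ _ j
    have h7 := norm_remainder_le hρ h1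
    rw [gFun_eq_add_remainder hρ i, norm_mul, Complex.norm_two]
    linarith [norm_add_le (gTerm n ρ (kZero n + 1 + i) z) (remainder n ρ i z)]

theorem toMeromorphicNFAt_of_analyticAt {f : ℂ → ℂ} {z : ℂ} (h : AnalyticAt ℂ f z) :
    toMeromorphicNFAt f z = f :=
  toMeromorphicNFAt_eq_self.2 h.meromorphicNFAt

theorem sphereValue_of_analyticAt {f : ℂ → ℂ} {z : ℂ} (h : AnalyticAt ℂ f z) :
    sphereValue f z = (f z : OnePoint ℂ) := by
  rw [sphereValue, if_neg (not_lt.2 h.meromorphicOrderAt_nonneg),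
    toMeromorphicNFAt_of_analyticAt h]

theorem IsAsymptoticValue.mem_image_closedBall {n : ℕ} {ρ : ℝ} (hρ : 0 < ρ) {a : OnePoint ℂ}
    (ha : IsAsymptoticValue (gFun n ρ) a) :
    a ∈ ((↑) : ℂ → OnePoint ℂ) '' Metric.closedBall 0 (4 * majorantSum n) := by
  obtain ⟨γ, hγ, hγi, hγa⟩ := ha
  have hcl : IsClosed (((↑) : ℂ → OnePoint ℂ) '' Metric.closedBall 0 (4 * majorantSum n)) :=
    ((isCompact_closedBall _ _).image OnePoint.continuous_coe).isClosed
  -- The image of the disc is compact, hence closed in the sphere, so visiting it at arbitrarily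
  -- large times suffices.
  refine hcl.mem_of_frequently_of_tendsto (frequently_atTop.2 fun T => ?_) hγa
  obtain ⟨m, hm, hγm⟩ := ((eventually_ge_atTop (kZero n + 1)).and
    ((tendsto_pFun (n := n) hρ).eventually_ge_atTop ‖γ (max T 0)‖)).exists
  obtain ⟨i, rfl⟩ := Nat.exists_eq_add_of_le hm
  obtain ⟨T', hT', hle⟩ := ((hγi.eventually_ge_atTop
    (pFun n ρ ((kZero n + 1 + i : ℕ) + 1 / 2))).and (eventually_ge_atTop (max T 0))).exists
  have hc : ContinuousOn (fun t => ‖γ t‖) (Set.Icc (max T 0) T') :=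
    (hγ.mono fun t ht => (le_max_right _ _).trans ht.1).norm
  obtain ⟨t, ht, hte⟩ := intermediate_value_Icc hle hc ⟨hγm, hT'⟩
  obtain ⟨h1, h2⟩ := gFun_of_norm_eq hρ hte
  exact ⟨t, (le_max_left _ _).trans ht.1, gFun n ρ (γ t), mem_closedBall_zero_iff.2 h2,
    (sphereValue_of_analyticAt h1).symm⟩

/-! ### Critical values -/

/-- Zeros of the denominator are true poles of `g`. Otherwise `g / 2` minus the remainder would have
a finite limit; multiplied by the denominator it would tend to 0, yet this product is the numerator,
whose limit is nonzero. -/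
theorem meromorphicOrderAt_gFun_neg {n : ℕ} {ρ : ℝ} (hρ : 0 < ρ) {i : ℕ} {z : ℂ}
    (hz : z ∈ annulus n ρ (kZero n + 1 + i)) (h0 : nSeq n ρ (kZero n + 1 + i) ≠ 0)
    (h : (z ^ nSeq n ρ (kZero n + 1 + i)) ^ 2 =
      (((pFun n ρ (kZero n + 1 + i : ℕ) : ℝ) : ℂ) ^ nSeq n ρ (kZero n + 1 + i)) ^ 2) :
    meromorphicOrderAt (gFun n ρ) z < 0 := by
  by_contra hcon
  set m := kZero n + 1 + i
  set ν := nSeq n ρ m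
  set b : ℂ := ((pFun n ρ m : ℝ) : ℂ) ^ ν with hb
  have hb0 : b ≠ 0 := by
    rw [hb, pFun_eq_exp (exp_le_iterate (by omega))]
    exact pow_ne_zero _ (by exact_mod_cast (Real.exp_pos _).ne')
  have ha0 : z ^ ν ≠ 0 := fun h' => hb0 (by simpa [h'] using h.symm)
  have hz0 : z ≠ 0 := fun h' => ha0 (by rw [h', zero_pow h0])
  obtain ⟨c, hc⟩ := (tendsto_nhds_iff_meromorphicOrderAt_nonneg (meromorphic_gFun hρ z)).2
    (not_lt.1 hcon)
  have hR : Tendsto (remainder n ρ i) (𝓝[≠] z) (𝓝 (remainder n ρ i z)) :=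
    (analyticAt_remainder hρ hz).continuousAt.tendsto.mono_left nhdsWithin_le_nhds
  have hden : HasDerivAt (fun w : ℂ => (w ^ ν) ^ 2 - b ^ 2) (2 * z ^ ν * (ν * z ^ (ν - 1))) z := by
    simpa using ((hasDerivAt_pow ν z).fun_pow 2).sub_const (b ^ 2)
  have hden0 : Tendsto (fun w : ℂ => (w ^ ν) ^ 2 - b ^ 2) (𝓝[≠] z) (𝓝 0) := by
    have := hden.continuousAt.tendsto.mono_left (nhdsWithin_le_nhds (s := {z}ᶜ))
    rwa [h, sub_self] at this
  have hnum : Tendsto (fun w : ℂ => w ^ ν * b) (𝓝[≠] z) (𝓝 (z ^ ν * b)) :=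
    Continuous.tendsto' (by fun_prop) _ _ rfl |>.mono_left nhdsWithin_le_nhds
  have hne := hden.eventually_ne (c := 0) (mul_ne_zero (mul_ne_zero two_ne_zero ha0)
    (mul_ne_zero (by exact_mod_cast h0) (pow_ne_zero _ hz0)))
  have h0' : Tendsto (fun w : ℂ => w ^ ν * b) (𝓝[≠] z) (𝓝 0) := by
    have := ((hc.div_const 2).sub hR).mul hden0
    rw [mul_zero] at this
    refine this.congr' ?_
    filter_upwards [hne] with w hw
    rw [gFun_eq_add_remainder hρ i, mul_div_cancel_left₀ _ two_ne_zero, add_sub_cancel_right,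
      gTerm_eq h0, div_mul_cancel₀ _ hw]
  exact mul_ne_zero ha0 hb0 (tendsto_nhds_unique hnum h0')

/-- A large term forces `ν |log ‖z‖ - logP n ρ m| < c / 4`, where `c = sepConst n`, whereas the
edges of the annulus are at distance at least `c / 2` on this scale. The radius is chosen so that `ν
log ‖w‖` differs from `ν log ‖z‖` by at most `c / 4`. -/
theorem closedBall_subset_annulus {n : ℕ} {ρ : ℝ} (hρ : 0 < ρ) {m : ℕ} (hm : kZero n < m) {z : ℂ}
    (h0 : nSeq n ρ m ≠ 0) (hz : Real.exp (-(sepConst n / 4)) /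
      (1 - Real.exp (-(sepConst n / 4)) ^ 2) < ‖gTerm n ρ m z‖) :
    Metric.closedBall z (sepConst n / 8 * ‖z‖ / nSeq n ρ m) ⊆ annulus n ρ m := by
  have hc := sepConst_pos n
  have hc4 := sepConst_le n
  have hz0 : z ≠ 0 := by
    rintro rfl
    rw [gTerm_eq h0, zero_pow h0, zero_mul, zero_div, norm_zero] at hz
    exact hz.not_ge (div_nonneg (Real.exp_pos _).le (by
      have : Real.exp (-(sepConst n / 4)) < 1 := by simpa using hc
      nlinarith [Real.exp_pos (-(sepConst n / 4))]))
  have hzn : 0 < ‖z‖ := norm_pos_iff.2 hz0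
  have hν := ratioP_div_two_le_nSeq hm.le h0
  have hν1 : (1 : ℝ) ≤ nSeq n ρ m := by exact_mod_cast Nat.one_le_iff_ne_zero.2 h0
  set ν : ℝ := (nSeq n ρ m : ℝ)
  have hm1 : (1 : ℝ) ≤ m := by exact_mod_cast (by omega : 1 ≤ m)
  have hlo : ν * (logP n ρ m - Real.log ‖z‖) < sepConst n / 4 := by
    by_contra! hcon
    exact hz.not_ge (norm_gTerm_le_of_norm_le hm.le (by linarith) (Real.exp_log hzn).ge
      fun _ => hcon)
  have hhi : ν * (Real.log ‖z‖ - logP n ρ m) < sepConst n / 4 := by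
    by_contra! hcon
    exact hz.not_ge (norm_gTerm_le_of_le_norm hm.le (by linarith) (Real.exp_log hzn).le
      fun _ => hcon)
  have hup : sepConst n / 2 ≤ ν * (logP n ρ (m + 1 / 2) - logP n ρ m) := by
    refine le_trans (le_of_eq ?_) (sepConst_mul_min_le_of_le hρ (exp_le_iterate hm.le)
      (by linarith) hν)
    rw [min_eq_left (by linarith)]
    ring
  have hdn : sepConst n / 2 ≤ ν * (logP n ρ m - logP n ρ (m - 1 / 2)) :=
    le_trans (le_of_eq (by ring)) (sepConst_mul_le_of_le hρ (iterate_exp_le_sub_half hm)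
      (by linarith) hν)
  set δ : ℝ := sepConst n / 8 / ν with hδ
  have hνδ : ν * δ = sepConst n / 8 := by rw [hδ]; field_simp
  have hδ0 : 0 < δ := by positivity
  have hδ1 : δ ≤ 1 / 2 := by nlinarith
  intro w hw
  rw [mem_closedBall_iff_norm, show sepConst n / 8 * ‖z‖ / ν = δ * ‖z‖ by rw [hδ]; ring] at hw
  have hw1 : ‖w‖ ≤ (1 + δ) * ‖z‖ := by linarith [norm_sub_norm_le w z]
  have hw2 : (1 - δ) * ‖z‖ ≤ ‖w‖ := by linarith [norm_sub_norm_le z w, norm_sub_rev w z]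
  refine ⟨?_, fun _ => ?_⟩
  · rw [pFun_eq_exp (iterate_exp_le_add_half hm.le)]
    calc ‖w‖ ≤ (1 + δ) * ‖z‖ := hw1
      _ ≤ Real.exp δ * Real.exp (Real.log ‖z‖) := by
          rw [Real.exp_log hzn]
          exact mul_le_mul_of_nonneg_right (by linarith [Real.add_one_le_exp δ]) hzn.le
      _ = Real.exp (δ + Real.log ‖z‖) := (Real.exp_add _ _).symm
      _ ≤ _ := Real.exp_le_exp.2 (le_of_mul_le_mul_left (by linarith) (by linarith : 0 < ν))
  · rw [pFun_eq_exp (iterate_exp_le_sub_half hm)]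
    -- Since `δ ≤ 1/2`, `(1 - δ)(1 + 2δ) ≥ 1`; the loss `2 * ν * δ = c / 4` is exactly what remains.
    have h1 : Real.exp (-(2 * δ)) ≤ 1 - δ := by
      rw [Real.exp_neg, inv_le_comm₀ (Real.exp_pos _) (by linarith), inv_le_iff_one_le_mul₀ (by linarith)]
      nlinarith [Real.add_one_le_exp (2 * δ)]
    calc Real.exp (logP n ρ (m - 1 / 2)) ≤ Real.exp (-(2 * δ) + Real.log ‖z‖) :=
          Real.exp_le_exp.2 (le_of_mul_le_mul_left (by linarith) (by linarith : 0 < ν))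
      _ = Real.exp (-(2 * δ)) * ‖z‖ := by rw [Real.exp_add, Real.exp_log hzn]
      _ ≤ (1 - δ) * ‖z‖ := mul_le_mul_of_nonneg_right h1 hzn.le
      _ ≤ ‖w‖ := hw2

/-- Here `q = (a² + b²) / (a² - b²)`, and `(a² + b²)² = (a² - b²)² + 4a²b²`. -/
theorem hasDerivAt_gTerm {n : ℕ} {ρ : ℝ} {k : ℕ} {z : ℂ} (hz : z ≠ 0) (h0 : nSeq n ρ k ≠ 0)
    (h : (z ^ nSeq n ρ k) ^ 2 ≠ (((pFun n ρ k : ℝ) : ℂ) ^ nSeq n ρ k) ^ 2) :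
    ∃ q : ℂ, q ^ 2 = 1 + 4 * gTerm n ρ k z ^ 2 ∧
      HasDerivAt (gTerm n ρ k) (-(gTerm n ρ k z * q * (nSeq n ρ k / z))) z := by
  have hT : gTerm n ρ k = _ := funext (gTerm_eq h0)
  rw [hT]
  set ν := nSeq n ρ k
  set b : ℂ := ((pFun n ρ k : ℝ) : ℂ) ^ ν
  have hd : (z ^ ν) ^ 2 - b ^ 2 ≠ 0 := sub_ne_zero.2 h
  have hpow : HasDerivAt (fun w : ℂ => w ^ ν) (z ^ ν * (ν / z)) z := by
    refine (hasDerivAt_pow ν z).congr_deriv ?_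
    rw [← pow_sub_one_mul h0]
    field_simp
  refine ⟨((z ^ ν) ^ 2 + b ^ 2) / ((z ^ ν) ^ 2 - b ^ 2), by field_simp; ring, ?_⟩
  refine ((hpow.mul_const b).fun_div ((hpow.fun_pow 2).sub_const (b ^ 2)) hd).congr_deriv ?_
  beta_reduce
  generalize z ^ ν = a at *
  field_simp
  ring

/-- A bound for the dominant term at critical points. -/
def termBound (n : ℕ) : ℝ :=
  1 + Real.exp (-(sepConst n / 4)) / (1 - Real.exp (-(sepConst n / 4)) ^ 2) +
    majorantSum n / (sepConst n / 8)

/-- The three bounds serve, in order, to get `‖q‖ ≥ 1`, to fit the Cauchy disc into the annulus, and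
to contradict the estimate obtained from `g' = 0`. -/
theorem termBound_spec (n : ℕ) : 1 ≤ termBound n ∧
    Real.exp (-(sepConst n / 4)) / (1 - Real.exp (-(sepConst n / 4)) ^ 2) ≤ termBound n ∧
    majorantSum n / (sepConst n / 8) ≤ termBound n := by
  have hc := sepConst_pos n
  have h1 : 0 ≤ Real.exp (-(sepConst n / 4)) / (1 - Real.exp (-(sepConst n / 4)) ^ 2) :=
    div_nonneg (Real.exp_pos _).le (by
      have : Real.exp (-(sepConst n / 4)) < 1 := by simpa using hc
      nlinarith [Real.exp_pos (-(sepConst n / 4))])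
  have h2 : 0 ≤ majorantSum n / (sepConst n / 8) := div_nonneg (majorantSum_nonneg n) (by linarith)
  unfold termBound
  exact ⟨by linarith, by linarith, by linarith⟩

theorem norm_gTerm_le_of_deriv_eq_zero {n : ℕ} {ρ : ℝ} (hρ : 0 < ρ) {i : ℕ} {z : ℂ}
    (hz : z ∈ annulus n ρ (kZero n + 1 + i)) (h0 : nSeq n ρ (kZero n + 1 + i) ≠ 0)
    (h : (z ^ nSeq n ρ (kZero n + 1 + i)) ^ 2 ≠
      (((pFun n ρ (kZero n + 1 + i : ℕ) : ℝ) : ℂ) ^ nSeq n ρ (kZero n + 1 + i)) ^ 2)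
    (hd : deriv (gFun n ρ) z = 0) :
    ‖gTerm n ρ (kZero n + 1 + i) z‖ ≤ termBound n := by
  obtain ⟨hM1, hM2, hM3⟩ := termBound_spec n
  by_contra! hcon
  have hz0 : z ≠ 0 := by
    rintro rfl
    rw [gTerm_eq h0, zero_pow h0, zero_mul, zero_div, norm_zero] at hcon
    linarith
  have hsub := closedBall_subset_annulus hρ (by omega) h0 (hM2.trans_lt hcon)
  obtain ⟨q, hq, hT⟩ := hasDerivAt_gTerm hz0 h0 h
  set m := kZero n + 1 + i
  set T := gTerm n ρ m z
  have hc := sepConst_pos n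
  have hzn : 0 < ‖z‖ := norm_pos_iff.2 hz0
  have hν : (0 : ℝ) < nSeq n ρ m := by exact_mod_cast Nat.pos_of_ne_zero h0
  set r := sepConst n / 8 * ‖z‖ / nSeq n ρ m with hr
  have hr0 : 0 < r := by positivity
  have hR := analyticAt_remainder hρ hz
  have hCauchy : ‖deriv (remainder n ρ i) z‖ ≤ majorantSum n / r := by
    refine Complex.norm_deriv_le_of_forall_mem_sphere_norm_le hr0
      (DifferentiableOn.diffContOnCl_ball (U := annulus n ρ m) (fun w hw =>
        (analyticAt_remainder hρ hw).differentiableAt.differentiableWithinAt) hsub) fun w hw => ?_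
    exact norm_remainder_le hρ (hsub (Metric.sphere_subset_closedBall hw))
  have hg : HasDerivAt (gFun n ρ)
      (2 * (-(T * q * (nSeq n ρ m / z)) + deriv (remainder n ρ i) z)) z := by
    have := (hT.add hR.differentiableAt.hasDerivAt).const_mul 2
    exact this.congr_of_eventuallyEq (Eventually.of_forall (gFun_eq_add_remainder hρ i))
  rw [hg.deriv, mul_eq_zero, or_iff_right two_ne_zero, neg_add_eq_zero] at hd
  have hq1 : 1 ≤ ‖q‖ := by
    have h1 : ‖(4 * T ^ 2 : ℂ)‖ ≤ ‖q ^ 2‖ + ‖(1 : ℂ)‖ := by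
      rw [show 4 * T ^ 2 = q ^ 2 - 1 by rw [hq]; ring]
      exact norm_sub_le _ _
    rw [norm_mul, norm_pow, norm_pow, norm_one] at h1
    norm_num at h1
    nlinarith [norm_nonneg q]
  have h2 : ‖T‖ * (nSeq n ρ m / ‖z‖) ≤ majorantSum n / (sepConst n / 8) * (nSeq n ρ m / ‖z‖) := by
    calc ‖T‖ * (nSeq n ρ m / ‖z‖) ≤ ‖T‖ * ‖q‖ * (nSeq n ρ m / ‖z‖) := by
          refine mul_le_mul_of_nonneg_right ?_ (by positivity)
          exact le_mul_of_one_le_right (norm_nonneg _) hq1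
      _ = ‖T * q * (nSeq n ρ m / z)‖ := by
          rw [norm_mul, norm_mul, norm_div, Complex.norm_natCast]
      _ ≤ majorantSum n / r := hd ▸ hCauchy
      _ = _ := by rw [hr]; field_simp
  have h3 := le_of_mul_le_mul_right h2 (by positivity)
  linarith

theorem norm_le_of_mem_finiteCriticalValues {n : ℕ} {ρ : ℝ} (hρ : 0 < ρ) {w : ℂ}
    (hw : w ∈ finiteCriticalValues (gFun n ρ)) : ‖w‖ ≤ 2 * (termBound n + majorantSum n) := by
  obtain ⟨z, hord, hd, rfl⟩ := hw
  obtain ⟨hM1, -, -⟩ := termBound_spec n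
  obtain ⟨m, hm, hz⟩ := exists_mem_annulus (n := n) hρ z
  by_cases hmk : m = kZero n
  -- The series starts at `kZero n + 1`, so the central disc has no dominant term.
  · subst hmk
    rw [toMeromorphicNFAt_of_analyticAt (analyticAt_gFun hρ fun k hk =>
      analyticAt_gTerm_of_mem_annulus hρ le_rfl hk.le hk.ne' hz), gFun, norm_mul, Complex.norm_two]
    have := norm_tsum_le_majorantSum (kZero n) fun j =>
      norm_gTerm_le_majorant hρ le_rfl (by omega : kZero n ≤ kZero n + 1 + j) (by omega) hz
    linarith
  · obtain ⟨i, rfl⟩ : ∃ i, m = kZero n + 1 + i := ⟨m - kZero n - 1, by omega⟩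
    have hne : nSeq n ρ (kZero n + 1 + i) ≠ 0 → (z ^ nSeq n ρ (kZero n + 1 + i)) ^ 2 ≠
        (((pFun n ρ (kZero n + 1 + i : ℕ) : ℝ) : ℂ) ^ nSeq n ρ (kZero n + 1 + i)) ^ 2 :=
      fun h0 h => hord.not_gt (meromorphicOrderAt_gFun_neg hρ hz h0 h)
    have han : AnalyticAt ℂ (gFun n ρ) z := analyticAt_gFun hρ fun k hk => by
      by_cases hkm : k = kZero n + 1 + i
      · exact hkm ▸ analyticAt_gTerm hne
      · exact analyticAt_gTerm_of_mem_annulus hρ hm hk.le hkm hz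
    rw [toMeromorphicNFAt_of_analyticAt han] at hd ⊢
    have hT : ‖gTerm n ρ (kZero n + 1 + i) z‖ ≤ termBound n := by
      by_cases h0 : nSeq n ρ (kZero n + 1 + i) = 0
      · rw [gTerm, if_pos h0, norm_zero]; linarith
      · exact norm_gTerm_le_of_deriv_eq_zero hρ hz h0 (hne h0) hd
    rw [gFun_eq_add_remainder hρ i, norm_mul, Complex.norm_two]
    linarith [norm_add_le (gTerm n ρ (kZero n + 1 + i) z) (remainder n ρ i z),
      norm_remainder_le hρ hz]

end

theorem mainTheorem3 (n : ℕ) (ρ : ℝ) (hρ : 0 < ρ) :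
    ConvergesLocallyUniformly (fun j => gTerm n ρ (kZero n + 1 + j)) ∧
    IsEremenkoLyubich (gFun n ρ) ∧
    ¬ IsAsymptoticValue (gFun n ρ) OnePoint.infty := by
  refine ⟨(hasLocalMajorants_gTerm hρ).convergesLocallyUniformly,
    ⟨meromorphic_gFun hρ, Bornology.IsBounded.closure (Bornology.IsBounded.union ?_ ?_)⟩,
    fun h => ?_⟩
  · exact (Metric.isBounded_closedBall (x := 0) (r := 2 * (termBound n + majorantSum n))).subset
      fun w hw => mem_closedBall_zero_iff.2 (norm_le_of_mem_finiteCriticalValues hρ hw)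
  · refine (Metric.isBounded_closedBall (x := 0) (r := 4 * majorantSum n)).subset fun a ha => ?_
    obtain ⟨w, hw, hwa⟩ := IsAsymptoticValue.mem_image_closedBall hρ ha
    exact OnePoint.coe_injective hwa ▸ hw
  · obtain ⟨w, -, hw⟩ := h.mem_image_closedBall hρ
    exact OnePoint.coe_ne_infty w hw
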